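/- **LLRK schemes.** For nonnegative integers $p,q$ put $$N_{p,q}(z)=\sum_{j=0}^{p}\frac{p(p-1)\cdots(p-j+1)}{(p+q)(p+q-1)\cdots(p+q-j+1)}\,\frac{z^j}{j!},\qquad D_{p,q}(z)=N_{q,p}(-z),$$ and let $P_{p,q}(M)=N_{p,q}(M)\,D_{p,q}(M)^{-1}$ be the $(p,q)$-Padé approximant of $e^{M}$ for a square matrix $M$. For an equation $x'=f(t,x)$ in dimension $d$, a point $(t,y)$ and a step size $h>0$, let $\widetilde D$ be the augmented matrix $$\widetilde D=\begin{pmatrix} f_x & f\\ 0&0\end{pmatrix}\ \text{(autonomous equations)}\qquad\text{or}\qquad \widetilde D=\begin{pmatrix} f_x & f_t & f\\ 0&0&1\\ 0&0&0\end{pmatrix}\ \text{(general equations)},$$ with entries evaluated at $(t,y)$. For real $\delta$ define $$\widetilde\phi(t,y;\delta)=L\,\bigl(P_{p,q}(2^{-\kappa}\widetilde D\delta)\bigr)^{2^{\kappa}}r,$$ where $L=[I_d\;\,0]$, $r=(0,\dots,0,1)^{\top}$, $\kappa$ is the smallest nonnegative integer with $\|2^{-\kappa}\widetilde D\delta\|\le\frac12$,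 and $\|\cdot\|$ is a fixed submultiplicative matrix norm. Given an explicit Runge–Kutta scheme with $s$ stages and real coefficients $(a_{ij},b_j,c_i)$, set $$\widetilde\rho(t,y;h)=h\sum_{j=1}^{s} b_j k_j,\qquad k_i=\widetilde q\Bigl(t+c_ih,\;h\sum_{j<i}a_{ij}k_j\Bigr),$$ $$\widetilde q(\tau,\xi)=f\bigl(\tau,y+\widetilde\phi(t,y;\tau-t)+\xi\bigr)-f_x(t,y)\,\widetilde\phi(t,y;\tau-t)-f_t(t,y)(\tau-t)-f(t,y).$$ The $(p,q)$-Padé LLRK scheme is the recursion $y_{n+1}=y_n+\widetilde\phi(t_n,y_n;h_n)+\widetilde\rho(t_n,y_n;h_n)$. **Stability.** Apply a one-step scheme to the scalar test equation $x'=\lambda x$ with $\lambda\in\mathbb C$, $\operatorname{Re}\lambda\le 0$. The scheme is *A-stable* if each step has the form $y_{n+1}=R\,y_n$ with $R=R(\lambda,t_n,y_n,h_n)\in\mathbb C$ and $|R|\le1$, for all such $\lambda$, all $t_n\in\mathbb R$, $y_n\in\mathbb C$ and $h_n>0$. (The factor may depend on $y_n$, since $\kappa$ does.) It is *L-stable*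 if in addition $R$ can be chosen so that $R\to0$ as $h_n\lambda\to\infty$ in the closed left half-plane, uniformly in $t_n$ and for $y_n$ and $h_n$ in bounded sets. **Theorem.** Let $p\le q\le p+2$. For every explicit Runge–Kutta scheme and every submultiplicative matrix norm, the $(p,q)$-Padé LLRK scheme is A-stable, both with the autonomous and with the general form of $\widetilde D$. If $q=p+1$ or $q=p+2$, it is moreover L-stable, again in both forms. -/

import Mathlib

noncomputable section

/-! ### Padé approximants of the exponential, scaling and squaring -/

/-- The numerator `N_{p,q}` of the `(p,q)`-Padé approximant of the exponential:
`∑_{j ≤ p} (p (p-1) ⋯ (p-j+1)) / ((p+q) (p+q-1) ⋯ (p+q-j+1)) * z^j / j!`. -/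
def padeNum (𝕜 : Type*) [RCLike 𝕜] (p q : ℕ) : Polynomial 𝕜 :=
  ∑ j ∈ Finset.range (p + 1),
    Polynomial.monomial j
      ((p.descFactorial j : 𝕜) / ((p + q).descFactorial j : 𝕜) / (j.factorial : 𝕜))

/-- The denominator `D_{p,q}(z) = N_{q,p}(-z)`, of degree `q`. -/
def padeDen (𝕜 : Type*) [RCLike 𝕜] (p q : ℕ) : Polynomial 𝕜 :=
  (padeNum 𝕜 q p).comp (-Polynomial.X)

/-- A matrix norm: a norm on square matrices that is submultiplicative. -/
structure IsMatrixNorm {𝕜 n : Type*} [RCLike 𝕜] [Fintype n] [DecidableEq n]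
    (ν : Seminorm 𝕜 (Matrix n n 𝕜)) : Prop where
  eq_zero : ∀ M, ν M = 0 → M = 0
  mul_le : ∀ M N, ν (M * N) ≤ ν M * ν N

section Exponential

variable {𝕜 n : Type*} [RCLike 𝕜] [Fintype n] [DecidableEq n]

/-- `P_{p,q}(M) = N_{p,q}(M) D_{p,q}(M)⁻¹` for a square matrix `M`. -/
def padeMatrix (p q : ℕ) (M : Matrix n n 𝕜) : Matrix n n 𝕜 :=
  Polynomial.aeval M (padeNum 𝕜 p q) * (Polynomial.aeval M (padeDen 𝕜 p q))⁻¹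

/-- The scaling exponent: the smallest `k = 0, 1, 2, …` with `‖2^{-k} M‖ ≤ 1/2`. -/
def scalingExponent (ν : Seminorm 𝕜 (Matrix n n 𝕜)) (M : Matrix n n 𝕜) : ℕ :=
  sInf {k : ℕ | ν (((2 : 𝕜)⁻¹ ^ k) • M) ≤ 1 / 2}

/-- Scaling and squaring: the approximation `(P_{p,q}(2^{-κ} M))^{2^κ}` of `e^M`. -/
def padeExp (ν : Seminorm 𝕜 (Matrix n n 𝕜)) (p q : ℕ) (M : Matrix n n 𝕜) : Matrix n n 𝕜 :=
  padeMatrix p q (((2 : 𝕜)⁻¹ ^ scalingExponent ν M) • M) ^ 2 ^ scalingExponent ν M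

end Exponential

/-! ### Explicit Runge-Kutta schemes -/

/-- Coefficients of an `s`-stage explicit Runge-Kutta scheme; only the entries `a i j` with `j < i`
are ever used. -/
structure RKCoeffs (s : ℕ) where
  a : Matrix (Fin s) (Fin s) ℝ
  b : Fin s → ℝ
  c : Fin s → ℝ

section Scheme

variable {𝕜 : Type*} [RCLike 𝕜] {d : ℕ}

/-- The stages `k_i = g (t + c_i h, h ∑_{j < i} a_{ij} k_j)` of the explicit Runge-Kutta scheme
applied, from the value `0` at time `t`, to `v' = g(s, v)`. -/
def rkStage {s : ℕ} (rk : RKCoeffs s) (g : ℝ → (Fin d → 𝕜) → (Fin d → 𝕜)) (t h : ℝ)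
    (i : Fin s) : Fin d → 𝕜 :=
  g (t + rk.c i * h) (h • ∑ j : {j : Fin s // j < i}, rk.a i j.1 • rkStage rk g t h j.1)
termination_by i
decreasing_by exact j.2

/-- The increment `h ∑_j b_j k_j` of one step from the value `0` at time `t`. -/
def rkIncrement {s : ℕ} (rk : RKCoeffs s) (g : ℝ → (Fin d → 𝕜) → (Fin d → 𝕜)) (t h : ℝ) :
    Fin d → 𝕜 :=
  h • ∑ j : Fin s, rk.b j • rkStage rk g t h j

/-! ### Local Linearization - Runge-Kutta schemes for `x' = f(t, x)` -/

/-- The Jacobian matrix `f_x(t, y)`. -/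
def jacX (f : ℝ → (Fin d → 𝕜) → (Fin d → 𝕜)) (t : ℝ) (y : Fin d → 𝕜) :
    Matrix (Fin d) (Fin d) 𝕜 :=
  LinearMap.toMatrix' (fderiv 𝕜 (f t) y : (Fin d → 𝕜) →ₗ[𝕜] (Fin d → 𝕜))

/-- The partial derivative `f_t(t, y)`. -/
def derivT (f : ℝ → (Fin d → 𝕜) → (Fin d → 𝕜)) (t : ℝ) (y : Fin d → 𝕜) : Fin d → 𝕜 :=
  deriv (fun s => f s y) t

/-- The matrix `[f_x, f; 0, 0]` of size `d + 1`, for autonomous equations. -/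
def augAutonomous (f : ℝ → (Fin d → 𝕜) → (Fin d → 𝕜)) (t : ℝ) (y : Fin d → 𝕜) :
    Matrix (Fin d ⊕ Fin 1) (Fin d ⊕ Fin 1) 𝕜 :=
  Matrix.fromBlocks (jacX f t y) (Matrix.of fun i _ => f t y i) 0 0

/-- The matrix `[f_x, f_t, f; 0, 0, 1; 0, 0, 0]` of size `d + 2`, for general equations. -/
def augNonautonomous (f : ℝ → (Fin d → 𝕜) → (Fin d → 𝕜)) (t : ℝ) (y : Fin d → 𝕜) :
    Matrix (Fin d ⊕ Fin 2) (Fin d ⊕ Fin 2) 𝕜 :=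
  Matrix.fromBlocks (jacX f t y) (Matrix.of fun i => ![derivT f t y i, f t y i]) 0 !![0, 1; 0, 0]

/-- `L (P_{p,q}(2^{-κ} D δ))^{2^κ} r` with `L = [I_d, 0]` and `r = (0, …, 0, 1)`: the approximation
of `φ(t, y; δ) = L e^{D δ} r`, where `D` is the augmented matrix at `(t, y)`. -/
def padePhi {m : ℕ}
    (ν : Seminorm 𝕜 (Matrix (Fin d ⊕ Fin (m + 1)) (Fin d ⊕ Fin (m + 1)) 𝕜)) (p q : ℕ)
    (D : Matrix (Fin d ⊕ Fin (m + 1)) (Fin d ⊕ Fin (m + 1)) 𝕜) (δ : ℝ) : Fin d → 𝕜 :=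
  (Matrix.fromCols 1 0 : Matrix (Fin d) (Fin d ⊕ Fin (m + 1)) 𝕜).mulVec
    ((padeExp ν p q ((δ : 𝕜) • D)).mulVec (Sum.elim 0 (Pi.single (Fin.last m) 1)))

/-- The vector field `q(t, y; s, ξ)` of the auxiliary equation, for a given approximation
`φ = φ(t, y; ·)`. -/
def auxField (f : ℝ → (Fin d → 𝕜) → (Fin d → 𝕜)) (t : ℝ) (y : Fin d → 𝕜)
    (φ : ℝ → Fin d → 𝕜) (s : ℝ) (ξ : Fin d → 𝕜) : Fin d → 𝕜 :=
  f s (y + φ (s - t) + ξ) - (jacX f t y).mulVec (φ (s - t)) - (s - t) • derivT f t y - f t y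

/-- One step `y + φ(t, y; h) + ρ(t, y; h)`, where `ρ` is the Runge-Kutta increment for the
auxiliary equation. -/
def llrkStep {s : ℕ} (rk : RKCoeffs s) (φ : ℝ → Fin d → 𝕜)
    (f : ℝ → (Fin d → 𝕜) → (Fin d → 𝕜)) (t : ℝ) (y : Fin d → 𝕜) (h : ℝ) : Fin d → 𝕜 :=
  y + φ h + rkIncrement rk (auxField f t y φ) t h

/-- The `(p,q)`-Padé LLRK scheme in its form for autonomous equations. -/
def llrkAutonomous (ν : Seminorm 𝕜 (Matrix (Fin d ⊕ Fin 1) (Fin d ⊕ Fin 1) 𝕜)) (p q : ℕ)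
    {s : ℕ} (rk : RKCoeffs s) (f : ℝ → (Fin d → 𝕜) → (Fin d → 𝕜)) (t : ℝ) (y : Fin d → 𝕜)
    (h : ℝ) : Fin d → 𝕜 :=
  llrkStep rk (padePhi ν p q (augAutonomous f t y)) f t y h

/-- The `(p,q)`-Padé LLRK scheme in its form for general, non-autonomous equations. -/
def llrkNonautonomous (ν : Seminorm 𝕜 (Matrix (Fin d ⊕ Fin 2) (Fin d ⊕ Fin 2) 𝕜)) (p q : ℕ)
    {s : ℕ} (rk : RKCoeffs s) (f : ℝ → (Fin d → 𝕜) → (Fin d → 𝕜)) (t : ℝ) (y : Fin d → 𝕜)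
    (h : ℝ) : Fin d → 𝕜 :=
  llrkStep rk (padePhi ν p q (augNonautonomous f t y)) f t y h

end Scheme

/-! ### Linear stability of one-step methods -/

/-- The right-hand side of the scalar test equation `x' = lam x`. -/
def testField (lam : ℂ) : ℝ → (Fin 1 → ℂ) → (Fin 1 → ℂ) := fun _ x => lam • x

/-- A one-step method for scalar complex equations: it sends the right-hand side `f`, the time
`t_n`, the value `y_n` and the step size `h_n` to `y_{n+1}`. -/
abbrev OneStepMethod : Type :=
  (ℝ → (Fin 1 → ℂ) → (Fin 1 → ℂ)) → ℝ → (Fin 1 → ℂ) → ℝ → (Fin 1 → ℂ)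

/-- On the test equation with `Re lam ≤ 0` one step of the method is
`y_{n+1} = R(lam, t_n, y_n, h_n) y_n`. The factor may depend on `y_n`, because
the scaling exponent of the schemes above does. -/
def IsAmplificationFactor (Φ : OneStepMethod) (R : ℂ → ℝ → (Fin 1 → ℂ) → ℝ → ℂ) : Prop :=
  ∀ (lam : ℂ) (t : ℝ) (y : Fin 1 → ℂ) (h : ℝ), lam.re ≤ 0 → 0 < h →
    Φ (testField lam) t y h = R lam t y h • y

/-- All values of the factor have modulus at most one. -/
def FactorBounded (R : ℂ → ℝ → (Fin 1 → ℂ) → ℝ → ℂ) : Prop :=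
  ∀ (lam : ℂ) (t : ℝ) (y : Fin 1 → ℂ) (h : ℝ), lam.re ≤ 0 → 0 < h → ‖R lam t y h‖ ≤ 1

/-- The factor tends to zero as `z = h lam → ∞` in the closed left half-plane, uniformly in `t`
and for `y` and `h` in bounded sets. -/
def FactorVanishesAtInfinity (R : ℂ → ℝ → (Fin 1 → ℂ) → ℝ → ℂ) : Prop :=
  ∀ (B H ε : ℝ), 0 < ε → ∃ r : ℝ, ∀ (lam : ℂ) (t : ℝ) (y : Fin 1 → ℂ) (h : ℝ),
    lam.re ≤ 0 → 0 < h → h ≤ H → ‖y‖ ≤ B → r ≤ ‖(h : ℂ) * lam‖ → ‖R lam t y h‖ ≤ ε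

/-- A-stability. -/
def IsAStable (Φ : OneStepMethod) : Prop :=
  ∃ R, IsAmplificationFactor Φ R ∧ FactorBounded R

/-- L-stability: A-stability together with `R → 0` as `h lam → ∞`. -/
def IsLStable (Φ : OneStepMethod) : Prop :=
  ∃ R, IsAmplificationFactor Φ R ∧ FactorBounded R ∧ FactorVanishesAtInfinity R

end

/-! On the test equation the auxiliary Runge–Kutta field is $\xi\mapsto\lambda\xi$, started at $0$;
every stage vanishes and the step is $y+\widetilde\phi$. The row vector $(1,0,\dots,0,y)$ is a left
eigenvector of the augmented matrix for $\lambda$, and $(0,\dots,0,1)$ is a left null vector.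
Pairing both with the last column of the Padé exponential gives
$y+\widetilde\phi=P_{p,q}(2^{-\kappa}z)^{2^\kappa}y$ with $z=h\lambda$ (`padePhi_eq`). Stability
thus reduces to bounds on scalar Padé approximants.

A-stability: numerators and denominators obey the same recurrences. Along the diagonal a combination
$xQ_{n+1}+yzQ_n$ descends to one of lower index, and $\operatorname{Re}(x\bar y)\le0$ survives the
descent when $\operatorname{Re}z\le0$ (`diagonal_comparison`). The first two superdiagonals are such
combinations with strict sign, so there $|P_{p,q}|<1$ off the origin.

L-stability: $\kappa$ keeps $2^{-\kappa}z$ in a half-annulus away from $0$ once $|z|$ is large. By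
compactness $|P_{p,q}|\le c<1$ there, and the power $2^\kappa$ tends to infinity with $|z|$
(`exists_norm_scaledPade_le`). -/

/-! ### Recurrences in the Padé table -/

open Polynomial in
theorem coeff_padeNum (𝕜 : Type*) [RCLike 𝕜] (p q j : ℕ) :
    (padeNum 𝕜 p q).coeff j =
      (p.descFactorial j : 𝕜) / ((p + q).descFactorial j : 𝕜) / (j.factorial : 𝕜) := by
  simp only [padeNum, finsetSum_coeff, coeff_monomial, Finset.sum_ite_eq', Finset.mem_range]
  split_ifs with h
  · rfl
  · rw [Nat.descFactorial_of_lt (by omega)]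
    simp

open Polynomial in
theorem padeNum_succ_succ_left (p q : ℕ) :
    padeNum ℂ (p + 1) (q + 1) = padeNum ℂ (p + 1) q -
      C ((p + 1 : ℂ) / ((p + q + 2) * (p + q + 1))) * (X * padeNum ℂ p q) := by
  have h1 : (p + q + 1 : ℂ) ≠ 0 := by exact_mod_cast (p + q).succ_ne_zero
  have h2 : (p + q + 2 : ℂ) ≠ 0 := by exact_mod_cast (p + q + 1).succ_ne_zero
  ext j
  rw [coeff_sub, coeff_C_mul]
  rcases j with _ | j
  · simp [coeff_padeNum]
  rw [coeff_X_mul]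
  simp only [coeff_padeNum]
  rcases lt_or_ge p j with hj | hj
  · simp only [Nat.succ_descFactorial_succ, Nat.descFactorial_of_lt hj]
    simp
  have h3 : ((p + q).descFactorial j : ℂ) ≠ 0 := by
    exact_mod_cast (Nat.descFactorial_pos.2 (by omega)).ne'
  have h4 : ((p + q + 1).descFactorial j : ℂ) ≠ 0 := by
    exact_mod_cast (Nat.descFactorial_pos.2 (by omega)).ne'
  have h5 : (j.factorial : ℂ) ≠ 0 := by exact_mod_cast j.factorial_ne_zero
  have h6 : (j + 1 : ℂ) ≠ 0 := by exact_mod_cast j.succ_ne_zero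
  obtain ⟨r, rfl⟩ := Nat.exists_eq_add_of_le hj
  -- The two sides carry falling factorials with adjacent tops; this relation identifies them.
  have h7 : ((r + q + 1 : ℂ)) * ((j + r + q + 1).descFactorial j : ℂ) =
      (j + r + q + 1) * ((j + r + q).descFactorial j : ℂ) := by
    have := Nat.succ_descFactorial (j + r + q) j
    rw [show j + r + q + 1 - j = r + q + 1 by omega] at this
    exact_mod_cast this
  rw [show j + r + 1 + (q + 1) = (j + r + q + 1) + 1 by ring,
    show j + r + 1 + q = (j + r + q) + 1 by ring]
  simp only [Nat.succ_descFactorial_succ, Nat.factorial_succ]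
  push_cast at *
  rw [show (j + r + q + 1 + 1 : ℂ) = j + r + q + 2 by ring]
  field_simp
  linear_combination (-(j : ℂ) - r - 1) * h7

open Polynomial in
theorem padeNum_succ_succ_right (p q : ℕ) :
    padeNum ℂ (p + 1) (q + 1) = padeNum ℂ p (q + 1) +
      C ((q + 1 : ℂ) / ((p + q + 2) * (p + q + 1))) * (X * padeNum ℂ p q) := by
  have h1 : (p + q + 1 : ℂ) ≠ 0 := by exact_mod_cast (p + q).succ_ne_zero
  have h2 : (p + q + 2 : ℂ) ≠ 0 := by exact_mod_cast (p + q + 1).succ_ne_zero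
  ext j
  rw [coeff_add, coeff_C_mul]
  rcases j with _ | j
  · simp [coeff_padeNum]
  rw [coeff_X_mul]
  simp only [coeff_padeNum]
  rcases lt_or_ge p j with hj | hj
  · simp only [Nat.succ_descFactorial_succ, Nat.descFactorial_of_lt hj,
      Nat.descFactorial_of_lt (hj.trans (Nat.lt_succ_self j))]
    simp
  have h3 : ((p + q).descFactorial j : ℂ) ≠ 0 := by
    exact_mod_cast (Nat.descFactorial_pos.2 (by omega)).ne'
  have h4 : ((p + q + 1).descFactorial j : ℂ) ≠ 0 := by
    exact_mod_cast (Nat.descFactorial_pos.2 (by omega)).ne'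
  have h5 : (j.factorial : ℂ) ≠ 0 := by exact_mod_cast j.factorial_ne_zero
  have h6 : (j + 1 : ℂ) ≠ 0 := by exact_mod_cast j.succ_ne_zero
  obtain ⟨r, rfl⟩ := Nat.exists_eq_add_of_le hj
  have h7 : ((r + q + 1 : ℂ)) * ((j + r + q + 1).descFactorial j : ℂ) =
      (j + r + q + 1) * ((j + r + q).descFactorial j : ℂ) := by
    have := Nat.succ_descFactorial (j + r + q) j
    rw [show j + r + q + 1 - j = r + q + 1 by omega] at this
    exact_mod_cast this
  rw [show j + r + 1 + (q + 1) = (j + r + q + 1) + 1 by ring,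
    show j + r + (q + 1) = (j + r + q) + 1 by ring, Nat.descFactorial_succ (j + r) j,
    show j + r - j = r by omega]
  simp only [Nat.succ_descFactorial_succ, Nat.factorial_succ]
  push_cast at *
  rw [show (j + r + q + 1 + 1 : ℂ) = j + r + q + 2 by ring]
  field_simp
  linear_combination (-(j : ℂ) - r - 1) * h7

/-- The two recurrences shared by the values at `z` of Padé numerators and denominators. -/
structure IsFrobeniusTable (z : ℂ) (Q : ℕ → ℕ → ℂ) : Prop where
  right : ∀ p q : ℕ, Q (p + 1) (q + 1) =
    Q p (q + 1) + (q + 1 : ℂ) / ((p + q + 2) * (p + q + 1)) * (z * Q p q)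
  left : ∀ p q : ℕ, Q (p + 1) (q + 1) =
    Q (p + 1) q - (p + 1 : ℂ) / ((p + q + 2) * (p + q + 1)) * (z * Q p q)

theorem isFrobeniusTable_padeNum (z : ℂ) :
    IsFrobeniusTable z fun p q => (padeNum ℂ p q).eval z := by
  constructor <;> intro p q
  · simpa using congrArg (Polynomial.eval z) (padeNum_succ_succ_right p q)
  · simpa using congrArg (Polynomial.eval z) (padeNum_succ_succ_left p q)

theorem eval_padeDen (p q : ℕ) (z : ℂ) :
    (padeDen ℂ p q).eval z = (padeNum ℂ q p).eval (-z) := by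
  simp [padeDen]

/-- Swapping $p,q$ and the sign of $z$ exchanges the two recurrences. -/
theorem isFrobeniusTable_padeDen (z : ℂ) :
    IsFrobeniusTable z fun p q => (padeDen ℂ p q).eval z := by
  have h := isFrobeniusTable_padeNum (-z)
  constructor <;> intro p q <;> simp only [eval_padeDen]
  · rw [h.left q p, add_comm (q : ℂ) p]
    ring
  · rw [h.right q p, add_comm (q : ℂ) p]
    ring

namespace IsFrobeniusTable

variable {z : ℂ} {Q : ℕ → ℕ → ℂ}

theorem first_superdiagonal (h : IsFrobeniusTable z Q) (n : ℕ) :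
    Q n (n + 1) = Q (n + 1) (n + 1) - ((1 / (2 * (2 * n + 1)) : ℝ) : ℂ) * (z * Q n n) := by
  have h1 : (2 * n + 1 : ℂ) ≠ 0 := by exact_mod_cast (2 * n).succ_ne_zero
  have h2 : (n + 1 : ℂ) ≠ 0 := by exact_mod_cast n.succ_ne_zero
  rw [h.right n n, show (n + n + 2 : ℂ) = 2 * (n + 1) by ring, ← two_mul (n : ℂ)]
  push_cast
  field_simp
  ring

/-- Equate the two expressions for $Q_{n+1,n+2}$; their coefficients of $zQ_{n,n+1}$ add up to
$1/(2n+2)$. -/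
theorem second_superdiagonal (h : IsFrobeniusTable z Q) (n : ℕ) :
    Q n (n + 2) = Q (n + 1) (n + 1) - ((1 / (2 * n + 2) : ℝ) : ℂ) * (z * Q n (n + 1)) := by
  have h1 : (2 * n + 3 : ℂ) ≠ 0 := by exact_mod_cast (2 * n + 2).succ_ne_zero
  have h2 : (n + 1 : ℂ) ≠ 0 := by exact_mod_cast n.succ_ne_zero
  have e1 := h.right n (n + 1)
  have e2 := h.left n (n + 1)
  rw [e2] at e1
  push_cast at *
  rw [show (n + (n + 1) + 2 : ℂ) = 2 * n + 3 by ring,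
    show (n + (n + 1) + 1 : ℂ) = 2 * (n + 1) by ring] at e1
  rw [show (2 * n + 2 : ℂ) = 2 * (n + 1) by ring]
  have e3 : (n + 1 : ℂ) / ((2 * n + 3) * (2 * (n + 1))) +
      (n + 1 + 1) / ((2 * n + 3) * (2 * (n + 1))) = 1 / (2 * (n + 1)) := by
    rw [← add_div, div_eq_div_iff (mul_ne_zero h1 (mul_ne_zero two_ne_zero h2))
      (mul_ne_zero two_ne_zero h2)]
    ring
  linear_combination -e1 - e3 * (z * Q n (n + 1))

/-- Two expressions for $Q_{n+1,n+2}$ again, with $Q_{n,n+1}$ eliminated. The terms in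
$zQ_{n+1,n+1}$ cancel, leaving a positive multiple of $z^2Q_{n,n}$. -/
theorem diagonal (h : IsFrobeniusTable z Q) (n : ℕ) :
    Q (n + 2) (n + 2) = Q (n + 1) (n + 1) +
      ((1 / (4 * (2 * n + 1) * (2 * n + 3)) : ℝ) : ℂ) * (z ^ 2 * Q n n) := by
  have h0 : (2 * n + 1 : ℂ) ≠ 0 := by exact_mod_cast (2 * n).succ_ne_zero
  have h1 : (2 * n + 3 : ℂ) ≠ 0 := by exact_mod_cast (2 * n + 2).succ_ne_zero
  have h2 : (n + 1 : ℂ) ≠ 0 := by exact_mod_cast n.succ_ne_zero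
  have h3 : (n + 2 : ℂ) ≠ 0 := by exact_mod_cast (n + 1).succ_ne_zero
  have e1 := h.first_superdiagonal (n + 1)
  have e2 := h.left n (n + 1)
  have e3 := h.first_superdiagonal n
  rw [e2, e3] at e1
  rw [show n + 1 + 1 = n + 2 from rfl] at e1
  push_cast at *
  rw [show (2 * (n + 1) + 1 : ℂ) = 2 * n + 3 by ring,
    show (n + (n + 1) + 2 : ℂ) = 2 * n + 3 by ring,
    show (n + (n + 1) + 1 : ℂ) = 2 * (n + 1) by ring] at e1
  have e4 : (n + 1 : ℂ) / ((2 * n + 3) * (2 * (n + 1))) = 1 / (2 * (2 * n + 3)) := by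
    field_simp
  have e5 : 1 / (4 * (2 * n + 1) * (2 * n + 3) : ℂ) =
      1 / (2 * (2 * n + 3)) * (1 / (2 * (2 * n + 1))) := by
    field_simp
    norm_num
  rw [e4] at e1
  rw [e5]
  linear_combination -e1

end IsFrobeniusTable

/-! ### Contractivity of Padé approximants in the left half-plane -/

theorem norm_add_half_le {u v : ℂ} (h : (u * starRingEnd ℂ v).re ≤ 0) :
    ‖u + v / 2‖ ≤ ‖u - v / 2‖ := by
  rw [← sq_le_sq₀ (norm_nonneg _) (norm_nonneg _), Complex.sq_norm, Complex.sq_norm,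
    Complex.normSq_apply, Complex.normSq_apply]
  simp at *
  nlinarith

theorem norm_add_half_lt {u v : ℂ} (h : (u * starRingEnd ℂ v).re < 0) :
    ‖u + v / 2‖ < ‖u - v / 2‖ := by
  rw [← sq_lt_sq₀ (norm_nonneg _) (norm_nonneg _), Complex.sq_norm, Complex.sq_norm,
    Complex.normSq_apply, Complex.normSq_apply]
  simp at *
  nlinarith

theorem re_mul_conj_recurrence (x y z : ℂ) :
    ((x + y * z) * starRingEnd ℂ (x * z)).re =
      Complex.normSq x * z.re + Complex.normSq z * (x * starRingEnd ℂ y).re := by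
  simp [Complex.normSq_apply]
  ring

/-- The recurrence sends the coefficient pair $(x,y)$ to $(x+yz,\ \beta xz)$, and
`re_mul_conj_recurrence` shows that the sign of $\operatorname{Re}(x\bar y)$, strict or not, is
preserved. Arbitrary pairs are needed for the induction to close. At the bottom, $N$ and $D$ give
$u\pm v/2$ with $u=x+yz$, $v=xz$. -/
theorem diagonal_comparison {z : ℂ} (hz : z.re ≤ 0) (hz0 : z ≠ 0) {N D : ℕ → ℂ} {β : ℕ → ℝ}
    (hβ : ∀ n, 0 < β n) (hN0 : N 0 = 1) (hD0 : D 0 = 1) (hN1 : N 1 = 1 + z / 2)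
    (hD1 : D 1 = 1 - z / 2) (hN : ∀ n, N (n + 2) = N (n + 1) + β n * (z ^ 2 * N n))
    (hD : ∀ n, D (n + 2) = D (n + 1) + β n * (z ^ 2 * D n)) (n : ℕ) :
    ∀ x y : ℂ, (x * starRingEnd ℂ y).re ≤ 0 → (x ≠ 0 ∨ y ≠ 0) →
      ‖x * N (n + 1) + y * (z * N n)‖ ≤ ‖x * D (n + 1) + y * (z * D n)‖ ∧
      x * D (n + 1) + y * (z * D n) ≠ 0 ∧
      ((x * starRingEnd ℂ y).re < 0 →
        ‖x * N (n + 1) + y * (z * N n)‖ < ‖x * D (n + 1) + y * (z * D n)‖) := by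
  have hzpos : 0 < Complex.normSq z := Complex.normSq_pos.2 hz0
  induction n with
  | zero =>
    intro x y hxy hne
    have key := re_mul_conj_recurrence x y z
    have e1 : x * N (0 + 1) + y * (z * N 0) = (x + y * z) + x * z / 2 := by
      rw [zero_add, hN1, hN0]; ring
    have e2 : x * D (0 + 1) + y * (z * D 0) = (x + y * z) - x * z / 2 := by
      rw [zero_add, hD1, hD0]; ring
    rw [e1, e2]
    have hxz : Complex.normSq x * z.re ≤ 0 :=
      mul_nonpos_of_nonneg_of_nonpos (Complex.normSq_nonneg x) hz
    refine ⟨norm_add_half_le ?_, ?_, fun h => norm_add_half_lt ?_⟩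
    · rw [key]; nlinarith
    · intro h0
      by_cases hx : x = 0
      · subst hx
        simp_all
      · have h1 : x + y * z = x * z / 2 := sub_eq_zero.1 h0
        rw [h1] at key
        have : (x * z / 2 * starRingEnd ℂ (x * z)).re = Complex.normSq (x * z) / 2 := by
          simp [Complex.normSq_apply]; ring
        rw [this] at key
        have := Complex.normSq_pos.2 (mul_ne_zero hx hz0)
        nlinarith
    · rw [key]; nlinarith
  | succ n ih =>
    intro x y hxy hne
    have e : ∀ Q : ℕ → ℂ, Q (n + 2) = Q (n + 1) + β n * (z ^ 2 * Q n) →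
        x * Q (n + 1 + 1) + y * (z * Q (n + 1)) =
          (x + y * z) * Q (n + 1) + β n * (x * z) * (z * Q n) := by
      intro Q hQ
      rw [show n + 1 + 1 = n + 2 from rfl, hQ]
      ring
    rw [e N (hN n), e D (hD n)]
    have hre : ((x + y * z) * starRingEnd ℂ (β n * (x * z))).re =
        β n * (Complex.normSq x * z.re + Complex.normSq z * (x * starRingEnd ℂ y).re) := by
      rw [← re_mul_conj_recurrence, map_mul, Complex.conj_ofReal, mul_left_comm,
        Complex.re_ofReal_mul]
    have hxz : Complex.normSq x * z.re ≤ 0 :=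
      mul_nonpos_of_nonneg_of_nonpos (Complex.normSq_nonneg x) hz
    have hβ0 : (β n : ℂ) ≠ 0 := by exact_mod_cast (hβ n).ne'
    obtain ⟨h1, h2, h3⟩ := ih (x + y * z) (β n * (x * z))
      (by rw [hre]; exact mul_nonpos_of_nonneg_of_nonpos (hβ n).le (by nlinarith)) (by
        by_cases hx : x = 0
        · left
          subst hx
          simp_all
        · right
          exact mul_ne_zero hβ0 (mul_ne_zero hx hz0))
    refine ⟨h1, h2, fun h => h3 ?_⟩
    rw [hre]
    exact mul_neg_of_pos_of_neg (hβ n) (by nlinarith)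

theorem eval_padeNum_zero_left (q : ℕ) (z : ℂ) : (padeNum ℂ 0 q).eval z = 1 := by
  simp [padeNum]

theorem eval_padeNum_one_one (z : ℂ) : (padeNum ℂ 1 1).eval z = 1 + z / 2 := by
  simp [padeNum, Finset.sum_range_succ, Nat.descFactorial]
  ring

theorem eval_padeNum_at_zero (p q : ℕ) : (padeNum ℂ p q).eval 0 = 1 := by
  rw [← Polynomial.coeff_zero_eq_eval_zero, coeff_padeNum]
  simp

theorem eval_padeDen_at_zero (p q : ℕ) : (padeDen ℂ p q).eval 0 = 1 := by
  rw [eval_padeDen, neg_zero, eval_padeNum_at_zero]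

theorem pade_diagonal_comparison {z : ℂ} (hz : z.re ≤ 0) (hz0 : z ≠ 0) (n : ℕ) (x y : ℂ)
    (hxy : (x * starRingEnd ℂ y).re ≤ 0) (hne : x ≠ 0 ∨ y ≠ 0) :
    let F : (ℕ → ℕ → ℂ) → ℂ := fun Q => x * Q (n + 1) (n + 1) + y * (z * Q n n)
    ‖F fun p q => (padeNum ℂ p q).eval z‖ ≤ ‖F fun p q => (padeDen ℂ p q).eval z‖ ∧
      (F fun p q => (padeDen ℂ p q).eval z) ≠ 0 ∧
      ((x * starRingEnd ℂ y).re < 0 →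
        ‖F fun p q => (padeNum ℂ p q).eval z‖ < ‖F fun p q => (padeDen ℂ p q).eval z‖) :=
  diagonal_comparison (N := fun n => (padeNum ℂ n n).eval z)
    (D := fun n => (padeDen ℂ n n).eval z) (β := fun n => 1 / (4 * (2 * n + 1) * (2 * n + 3)))
    hz hz0 (fun n => by positivity) (eval_padeNum_zero_left 0 z)
    (by rw [eval_padeDen, eval_padeNum_zero_left]) (eval_padeNum_one_one z)
    (by rw [eval_padeDen, eval_padeNum_one_one]; ring)
    (isFrobeniusTable_padeNum z).diagonal (isFrobeniusTable_padeDen z).diagonal n x y hxy hne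

/-- In the punctured closed left half-plane, Padé approximants above the diagonal are strictly
contractive. -/
theorem norm_padeNum_lt_padeDen {p q : ℕ} (hq : q = p + 1 ∨ q = p + 2) {z : ℂ} (hz : z.re ≤ 0)
    (hz0 : z ≠ 0) : ‖(padeNum ℂ p q).eval z‖ < ‖(padeDen ℂ p q).eval z‖ := by
  have hN := isFrobeniusTable_padeNum z
  have hD := isFrobeniusTable_padeDen z
  set a : ℝ := 1 / (2 * (2 * p + 1)) with ha
  have ha0 : 0 < a := by positivity
  rcases hq with rfl | rfl
  · have e : ∀ Q : ℕ → ℕ → ℂ, IsFrobeniusTable z Q →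
        Q p (p + 1) = 1 * Q (p + 1) (p + 1) + (-a : ℂ) * (z * Q p p) := by
      intro Q hQ
      rw [hQ.first_superdiagonal, ← ha]
      ring
    rw [e _ hN, e _ hD]
    -- A strict sign in the initial pair is what makes the final inequality strict.
    have hre : ((1 : ℂ) * starRingEnd ℂ (-a : ℂ)).re < 0 := by simpa using ha0
    exact (pade_diagonal_comparison hz hz0 p 1 (-a) hre.le (Or.inl one_ne_zero)).2.2 hre
  · set b : ℝ := 1 / (2 * p + 2) with hb
    have hb0 : 0 < b := by positivity
    have e : ∀ Q : ℕ → ℕ → ℂ, IsFrobeniusTable z Q →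
        Q p (p + 2) = (1 - b * z) * Q (p + 1) (p + 1) + (a * b * z : ℂ) * (z * Q p p) := by
      intro Q hQ
      rw [hQ.second_superdiagonal, hQ.first_superdiagonal, ← ha, ← hb]
      ring
    rw [e _ hN, e _ hD]
    have hre : ((1 - b * z : ℂ) * starRingEnd ℂ (a * b * z : ℂ)).re < 0 := by
      have h1 : ((1 - b * z : ℂ) * starRingEnd ℂ (a * b * z : ℂ)).re =
          a * b * (z.re - b * Complex.normSq z) := by
        simp [Complex.normSq_apply]
        ring
      rw [h1]
      have := mul_pos hb0 (Complex.normSq_pos.2 hz0)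
      exact mul_neg_of_pos_of_neg (mul_pos ha0 hb0) (by linarith)
    have hab : (a * b * z : ℂ) ≠ 0 :=
      mul_ne_zero (by exact_mod_cast (mul_pos ha0 hb0).ne') hz0
    exact (pade_diagonal_comparison hz hz0 p _ _ hre.le (Or.inr hab)).2.2 hre

theorem padeDen_ne_zero_and_norm_le {p q : ℕ} (hpq : p ≤ q) (hqp : q ≤ p + 2) {z : ℂ}
    (hz : z.re ≤ 0) : (padeDen ℂ p q).eval z ≠ 0 ∧
      ‖(padeNum ℂ p q).eval z‖ ≤ ‖(padeDen ℂ p q).eval z‖ := by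
  by_cases hz0 : z = 0
  · subst hz0
    simp [eval_padeDen_at_zero, eval_padeNum_at_zero]
  obtain rfl | hq : q = p ∨ (q = p + 1 ∨ q = p + 2) := by omega
  · rcases q with _ | n
    · simp [eval_padeDen, eval_padeNum_zero_left]
    · have := pade_diagonal_comparison hz hz0 n 1 0 (by simp) (Or.inl one_ne_zero)
      simp only [one_mul, zero_mul, add_zero] at this
      exact ⟨this.2.1, this.1⟩
  · have := norm_padeNum_lt_padeDen hq hz hz0
    exact ⟨norm_pos_iff.1 ((norm_nonneg _).trans_lt this), this.le⟩

/-! ### Left eigenvectors under scaling and squaring -/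

theorem vecMul_aeval {n : Type*} [Fintype n] [DecidableEq n] {M : Matrix n n ℂ} {u : n → ℂ} {w : ℂ}
    (h : Matrix.vecMul u M = w • u) (P : Polynomial ℂ) :
    Matrix.vecMul u (Polynomial.aeval M P) = P.eval w • u := by
  have hpow : ∀ k : ℕ, Matrix.vecMul u (M ^ k) = w ^ k • u := by
    intro k
    induction k with
    | zero => simp
    | succ k ih =>
      rw [pow_succ, ← Matrix.vecMul_vecMul, ih, Matrix.smul_vecMul, h, smul_smul, pow_succ]
  induction P using Polynomial.induction_on' with
  | add P Q hP hQ => rw [map_add, Matrix.vecMul_add, hP, hQ, Polynomial.eval_add, add_smul]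
  | monomial k a =>
    rw [Polynomial.aeval_monomial, Polynomial.eval_monomial, ← Algebra.smul_def,
      Matrix.vecMul_smul, hpow, smul_smul]

theorem vecMul_padeMatrix_pow {n : Type*} [Fintype n] [DecidableEq n] {M : Matrix n n ℂ}
    {u : n → ℂ} {w : ℂ} {p q : ℕ} (h : Matrix.vecMul u M = w • u)
    (hM : IsUnit (Polynomial.aeval M (padeDen ℂ p q))) (hw : (padeDen ℂ p q).eval w ≠ 0) (k : ℕ) :
    Matrix.vecMul u (padeMatrix p q M ^ k) =
      ((padeNum ℂ p q).eval w / (padeDen ℂ p q).eval w) ^ k • u := by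
  have h1 : Matrix.vecMul u (padeMatrix p q M) =
      ((padeNum ℂ p q).eval w / (padeDen ℂ p q).eval w) • u := by
    have hinv := Matrix.mul_nonsing_inv _ ((Matrix.isUnit_iff_isUnit_det _).1 hM)
    have h2 : Matrix.vecMul u (Polynomial.aeval M (padeDen ℂ p q))⁻¹ =
        ((padeDen ℂ p q).eval w)⁻¹ • u := by
      have := congrArg (Matrix.vecMul u) hinv
      rw [← Matrix.vecMul_vecMul, vecMul_aeval h, Matrix.smul_vecMul, Matrix.vecMul_one] at this
      rw [eq_inv_smul_iff₀ hw, this]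
    rw [padeMatrix, ← Matrix.vecMul_vecMul, vecMul_aeval h, Matrix.smul_vecMul, h2, smul_smul,
      div_eq_mul_inv]
  induction k with
  | zero => simp
  | succ k ih =>
    rw [pow_succ, ← Matrix.vecMul_vecMul, ih, Matrix.smul_vecMul, h1, smul_smul, pow_succ]

-- $P$ is coprime to the annihilating cubic $X^2(X-w)$, so a Bézout identity evaluated at $M$
-- inverts $P(M)$. The square on $X$ accommodates the nilpotent time block of the general form.
open Polynomial in
theorem isUnit_aeval_of_mul_mul_sub_eq_zero {n : Type*} [Fintype n] [DecidableEq n]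
    {M : Matrix n n ℂ} {w : ℂ} (h : M * M * (M - w • 1) = 0) {P : ℂ[X]} (h0 : P.eval 0 ≠ 0)
    (hw : P.eval w ≠ 0) : IsUnit (aeval M P) := by
  have hcop : ∀ a : ℂ, P.eval a ≠ 0 → IsCoprime P (X - C a) := by
    intro a ha
    refine ((irreducible_X_sub_C a).coprime_iff_not_dvd.2 ?_).symm
    rwa [dvd_iff_isRoot]
  have h0' : IsCoprime P X := by simpa using hcop 0 h0
  obtain ⟨A, B, hAB⟩ := (h0'.mul_right h0').mul_right (hcop w hw)
  have := congrArg (aeval M) hAB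
  have hz : aeval M (X * X * (X - C w)) = 0 := by
    simpa [Algebra.algebraMap_eq_smul_one] using h
  rw [map_add, map_mul, map_mul, hz, mul_zero, add_zero, map_one] at this
  exact IsUnit.of_mul_eq_one_right _ this

/-- The factor `(P_{p,q}(2^{-κ} z))^{2^κ}` obtained by scaling and squaring with exponent `κ`. -/
noncomputable def scaledPade (p q κ : ℕ) (z : ℂ) : ℂ :=
  ((padeNum ℂ p q).eval ((2 : ℂ)⁻¹ ^ κ * z) / (padeDen ℂ p q).eval ((2 : ℂ)⁻¹ ^ κ * z)) ^ 2 ^ κ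

theorem vecMul_padeExp {n : Type*} [Fintype n] [DecidableEq n] (ν : Seminorm ℂ (Matrix n n ℂ))
    {M : Matrix n n ℂ} {u : n → ℂ} {w z : ℂ} {p q : ℕ} (h : Matrix.vecMul u M = w • u)
    (hM : M * M * (M - z • 1) = 0)
    (hw : (padeDen ℂ p q).eval ((2 : ℂ)⁻¹ ^ scalingExponent ν M * w) ≠ 0)
    (hz : (padeDen ℂ p q).eval ((2 : ℂ)⁻¹ ^ scalingExponent ν M * z) ≠ 0) :
    Matrix.vecMul u (padeExp ν p q M) = scaledPade p q (scalingExponent ν M) w • u := by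
  refine vecMul_padeMatrix_pow ?_ (isUnit_aeval_of_mul_mul_sub_eq_zero ?_ ?_ hz) hw _
  · rw [Matrix.vecMul_smul, h, smul_smul]
  · rw [mul_smul, ← smul_sub]
    simp only [Algebra.smul_mul_assoc, Algebra.mul_smul_comm, hM, smul_zero]
  · rw [eval_padeDen_at_zero]
    exact one_ne_zero

theorem re_scaled_nonpos {z : ℂ} (hz : z.re ≤ 0) (κ : ℕ) : ((2 : ℂ)⁻¹ ^ κ * z).re ≤ 0 := by
  have : ((2 : ℂ)⁻¹ ^ κ) = (((2 : ℝ)⁻¹ ^ κ : ℝ) : ℂ) := by push_cast; rfl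
  rw [this, Complex.re_ofReal_mul]
  exact mul_nonpos_of_nonneg_of_nonpos (by positivity) hz

theorem norm_scaledPade_le_one {p q : ℕ} (hpq : p ≤ q) (hqp : q ≤ p + 2) {z : ℂ} (hz : z.re ≤ 0)
    (κ : ℕ) : ‖scaledPade p q κ z‖ ≤ 1 := by
  obtain ⟨h0, h1⟩ := padeDen_ne_zero_and_norm_le hpq hqp (re_scaled_nonpos hz κ)
  rw [scaledPade, norm_pow, norm_div]
  exact pow_le_one₀ (by positivity) (div_le_one_of_le₀ h1 (norm_nonneg _))

theorem padePhi_eq {m p q : ℕ} (hpq : p ≤ q) (hqp : q ≤ p + 2)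
    (ν : Seminorm ℂ (Matrix (Fin 1 ⊕ Fin (m + 1)) (Fin 1 ⊕ Fin (m + 1)) ℂ))
    {D : Matrix (Fin 1 ⊕ Fin (m + 1)) (Fin 1 ⊕ Fin (m + 1)) ℂ} {lam : ℂ} {y : Fin 1 → ℂ} {h : ℝ}
    (hlam : lam.re ≤ 0) (hh : 0 < h) (hD : D * D * (D - lam • 1) = 0)
    (hu : Matrix.vecMul (Sum.elim 1 (Pi.single (Fin.last m) (y 0))) D =
      lam • (Sum.elim 1 (Pi.single (Fin.last m) (y 0)) : Fin 1 ⊕ Fin (m + 1) → ℂ))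
    (he : Matrix.vecMul (Sum.elim 0 (Pi.single (Fin.last m) 1)) D = 0) :
    y + padePhi ν p q D h = scaledPade p q (scalingExponent ν ((h : ℂ) • D)) (h * lam) • y := by
  set M := (h : ℂ) • D with hM
  set κ := scalingExponent ν M
  have hre : ((h : ℂ) * lam).re ≤ 0 := by
    rw [Complex.re_ofReal_mul]
    exact mul_nonpos_of_nonneg_of_nonpos hh.le hlam
  have hM0 : M * M * (M - ((h : ℂ) * lam) • 1) = 0 := by
    rw [mul_smul, hM, ← smul_sub]
    simp only [Algebra.smul_mul_assoc, Algebra.mul_smul_comm, hD, smul_zero]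
  have hz := (padeDen_ne_zero_and_norm_le hpq hqp (re_scaled_nonpos hre κ)).1
  have h1 := vecMul_padeExp (w := h * lam) ν (p := p) (q := q) (M := M)
    (u := Sum.elim 1 (Pi.single (Fin.last m) (y 0)))
    (by rw [hM, Matrix.vecMul_smul, hu, smul_smul]) hM0 hz hz
  have h2 := vecMul_padeExp (w := 0) ν (p := p) (q := q) (M := M)
    (u := Sum.elim 0 (Pi.single (Fin.last m) 1))
    (by rw [hM, Matrix.vecMul_smul, he, smul_zero, zero_smul]) hM0
    (by rw [mul_zero, eval_padeDen_at_zero]; exact one_ne_zero) hz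
  have h3 : scaledPade p q (scalingExponent ν M) 0 = 1 := by
    simp [scaledPade, eval_padeDen_at_zero, eval_padeNum_at_zero]
  rw [h3, one_smul] at h2
  -- With $E$ the Padé exponential, the last coordinates read
  -- $E_{0,\mathrm{last}}+yE_{\mathrm{last},\mathrm{last}}=Ry$ and
  -- $E_{\mathrm{last},\mathrm{last}}=1$; the entry $E_{0,\mathrm{last}}$ is $\widetilde\phi$.
  have e1 := congrFun h1 (Sum.inr (Fin.last m))
  have e2 := congrFun h2 (Sum.inr (Fin.last m))
  simp [Matrix.vecMul, dotProduct, Pi.single_apply] at e1 e2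
  ext i
  obtain rfl : i = 0 := Subsingleton.elim _ _
  simp [padePhi, ← hM]
  rw [e2] at e1
  linear_combination e1

/-! ### The schemes on the test equation -/

theorem rkStage_linear {d s : ℕ} (rk : RKCoeffs s) (lam : ℂ) (t h : ℝ) (i : Fin s) :
    rkStage rk (fun _ (ξ : Fin d → ℂ) => lam • ξ) t h i = 0 := by
  induction i using WellFoundedLT.induction with
  | _ i ih =>
    rw [rkStage, Finset.sum_eq_zero, smul_zero, smul_zero]
    intro j _
    rw [ih j.1 j.2, smul_zero]

theorem jacX_testField (lam : ℂ) (t : ℝ) (y : Fin 1 → ℂ) : jacX (testField lam) t y = lam • 1 := by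
  have : fderiv ℂ (testField lam t) y = lam • ContinuousLinearMap.id ℂ (Fin 1 → ℂ) := by
    exact ((ContinuousLinearMap.id ℂ (Fin 1 → ℂ)).hasFDerivAt.const_smul lam).fderiv
  rw [jacX, this]
  simp

theorem derivT_testField (lam : ℂ) (t : ℝ) (y : Fin 1 → ℂ) : derivT (testField lam) t y = 0 := by
  simp [derivT, testField]

theorem llrkStep_testField {s : ℕ} (rk : RKCoeffs s) (φ : ℝ → Fin 1 → ℂ) (lam : ℂ) (t : ℝ)
    (y : Fin 1 → ℂ) (h : ℝ) : llrkStep rk φ (testField lam) t y h = y + φ h := by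
  have : auxField (testField lam) t y φ = fun _ ξ => lam • ξ := by
    ext r ξ i
    simp [auxField, jacX_testField, derivT_testField, testField, Matrix.smul_mulVec]
    ring
  simp [llrkStep, this, rkIncrement, rkStage_linear]

theorem augAutonomous_testField (lam : ℂ) (t : ℝ) (y : Fin 1 → ℂ) :
    augAutonomous (testField lam) t y =
      Matrix.fromBlocks (lam • 1) (Matrix.of fun _ _ => lam * y 0) 0 0 := by
  rw [augAutonomous, jacX_testField]
  congr
  ext i j
  fin_cases i
  simp [testField]

theorem augNonautonomous_testField (lam : ℂ) (t : ℝ) (y : Fin 1 → ℂ) :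
    augNonautonomous (testField lam) t y =
      Matrix.fromBlocks (lam • 1) (Matrix.of fun _ => ![0, lam * y 0]) 0 !![0, 1; 0, 0] := by
  rw [augNonautonomous, jacX_testField, derivT_testField]
  congr
  ext i j
  fin_cases i
  simp [testField]

theorem vecMul_augAutonomous (lam : ℂ) (t : ℝ) (y : Fin 1 → ℂ) :
    Matrix.vecMul (Sum.elim 1 (Pi.single (Fin.last 0) (y 0))) (augAutonomous (testField lam) t y) =
      lam • (Sum.elim 1 (Pi.single (Fin.last 0) (y 0)) : Fin 1 ⊕ Fin 1 → ℂ) := by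
  rw [augAutonomous_testField]
  ext j
  rcases j with j | j <;> fin_cases j <;> simp [Matrix.vecMul, dotProduct]

theorem vecMul_augNonautonomous (lam : ℂ) (t : ℝ) (y : Fin 1 → ℂ) :
    Matrix.vecMul (Sum.elim 1 (Pi.single (Fin.last 1) (y 0)))
        (augNonautonomous (testField lam) t y) =
      lam • (Sum.elim 1 (Pi.single (Fin.last 1) (y 0)) : Fin 1 ⊕ Fin 2 → ℂ) := by
  rw [augNonautonomous_testField]
  ext j
  rcases j with j | j <;> fin_cases j <;>
    simp [Matrix.vecMul, dotProduct, Fin.sum_univ_two, Fin.last]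

theorem llrkAutonomous_testField {p q : ℕ} (hpq : p ≤ q) (hqp : q ≤ p + 2) {s : ℕ} (rk : RKCoeffs s)
    (ν : Seminorm ℂ (Matrix (Fin 1 ⊕ Fin 1) (Fin 1 ⊕ Fin 1) ℂ)) {lam : ℂ} (t : ℝ) (y : Fin 1 → ℂ)
    {h : ℝ} (hlam : lam.re ≤ 0) (hh : 0 < h) :
    llrkAutonomous ν p q rk (testField lam) t y h =
      scaledPade p q (scalingExponent ν ((h : ℂ) • augAutonomous (testField lam) t y))
        (h * lam) • y := by
  rw [llrkAutonomous, llrkStep_testField,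
    padePhi_eq hpq hqp ν hlam hh ?_ (vecMul_augAutonomous lam t y)] <;>
    rw [augAutonomous_testField]
  · ext j
    rcases j with j | j <;> fin_cases j <;> simp [Matrix.vecMul, dotProduct]
  · ext i j
    rcases i with i | i <;> rcases j with j | j <;> fin_cases i <;> fin_cases j <;>
      simp [Matrix.mul_apply, Matrix.one_apply]
    ring

theorem llrkNonautonomous_testField {p q : ℕ} (hpq : p ≤ q) (hqp : q ≤ p + 2) {s : ℕ}
    (rk : RKCoeffs s) (ν : Seminorm ℂ (Matrix (Fin 1 ⊕ Fin 2) (Fin 1 ⊕ Fin 2) ℂ)) {lam : ℂ} (t : ℝ)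
    (y : Fin 1 → ℂ) {h : ℝ} (hlam : lam.re ≤ 0) (hh : 0 < h) :
    llrkNonautonomous ν p q rk (testField lam) t y h =
      scaledPade p q (scalingExponent ν ((h : ℂ) • augNonautonomous (testField lam) t y))
        (h * lam) • y := by
  rw [llrkNonautonomous, llrkStep_testField,
    padePhi_eq hpq hqp ν hlam hh ?_ (vecMul_augNonautonomous lam t y)] <;>
    rw [augNonautonomous_testField]
  · ext j
    rcases j with j | j <;> fin_cases j <;>
      simp [Matrix.vecMul, dotProduct, Fin.sum_univ_two, Fin.last]
  · ext i j
    rcases i with i | i <;> rcases j with j | j <;> fin_cases i <;> fin_cases j <;>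
      simp [Matrix.mul_apply, Matrix.one_apply, Fin.sum_univ_two]
    ring

/-! ### Size of the scaled argument and decay at infinity -/

theorem norm_inv_two_pow (κ : ℕ) : ‖(2 : ℂ)⁻¹ ^ κ‖ = ((2 : ℝ) ^ κ)⁻¹ := by
  simp

theorem seminorm_scaled_le_half {n : Type*} {ν : Seminorm ℂ (Matrix n n ℂ)} (M : Matrix n n ℂ) :
    ν (((2 : ℂ)⁻¹ ^ scalingExponent ν M) • M) ≤ 1 / 2 := by
  refine Nat.sInf_mem (s := {k : ℕ | ν (((2 : ℂ)⁻¹ ^ k) • M) ≤ 1 / 2}) ?_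
  obtain ⟨k, hk⟩ := pow_unbounded_of_one_lt (2 * ν M) (one_lt_two (α := ℝ))
  refine ⟨k, ?_⟩
  rw [Set.mem_ofPred_eq, map_smul_eq_mul, norm_inv_two_pow, inv_mul_le_iff₀ (by positivity)]
  linarith

/-- By minimality the exponent one below fails the bound $1/2$. -/
theorem two_pow_scalingExponent_lt {n : Type*} {ν : Seminorm ℂ (Matrix n n ℂ)} {M : Matrix n n ℂ}
    (h : scalingExponent ν M ≠ 0) :
    (2 : ℝ) ^ scalingExponent ν M < 4 * ν M := by
  obtain ⟨k, hk⟩ := Nat.exists_eq_succ_of_ne_zero h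
  have hlt : k < sInf {k : ℕ | ν (((2 : ℂ)⁻¹ ^ k) • M) ≤ 1 / 2} := by
    change k < scalingExponent ν M
    omega
  have := Nat.notMem_of_lt_sInf hlt
  rw [Set.mem_ofPred_eq, map_smul_eq_mul, norm_inv_two_pow, inv_mul_le_iff₀ (by positivity)] at this
  rw [hk, pow_succ]
  linarith

theorem norm_le_of_vecMul_eq_smul {n : Type*} [Fintype n] [DecidableEq n]
    {ν : Seminorm ℂ (Matrix n n ℂ)} (hν : IsMatrixNorm ν) {M : Matrix n n ℂ} {u : n → ℂ} {w : ℂ}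
    (hu : u ≠ 0) (h : Matrix.vecMul u M = w • u) : ‖w‖ ≤ ν M := by
  -- The rank-one matrix $uu^{\top}$ turns the row eigenvector into a matrix, to which
  -- submultiplicativity applies.
  have h1 : Matrix.vecMulVec u u * M = w • Matrix.vecMulVec u u := by
    rw [Matrix.vecMulVec_mul, h, Matrix.vecMulVec_smul]
  have h2 : Matrix.vecMulVec u u ≠ 0 := by
    obtain ⟨i, hi⟩ := Function.ne_iff.1 hu
    exact fun h0 => mul_ne_zero hi hi (congrFun (congrFun h0 i) i)
  have h3 : 0 < ν (Matrix.vecMulVec u u) :=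
    (apply_nonneg ν _).lt_of_ne fun h0 => h2 (hν.eq_zero _ h0.symm)
  have h4 := hν.mul_le (Matrix.vecMulVec u u) M
  rw [h1, map_smul_eq_mul, mul_comm] at h4
  exact le_of_mul_le_mul_left h4 h3

theorem norm_scaled_le_half {n : Type*} [Fintype n] [DecidableEq n]
    {ν : Seminorm ℂ (Matrix n n ℂ)} (hν : IsMatrixNorm ν) {M : Matrix n n ℂ} {u : n → ℂ} {z : ℂ}
    (hu : u ≠ 0) (h : Matrix.vecMul u M = z • u) :
    ‖(2 : ℂ)⁻¹ ^ scalingExponent ν M * z‖ ≤ 1 / 2 :=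
  (norm_le_of_vecMul_eq_smul hν hu (by rw [Matrix.vecMul_smul, h, smul_smul])).trans
    (seminorm_scaled_le_half M)

theorem exists_uniform_contraction {p q : ℕ} (hq : q = p + 1 ∨ q = p + 2) {a : ℝ} (ha : 0 < a) :
    ∃ c, 0 ≤ c ∧ c < 1 ∧ ∀ w : ℂ, w.re ≤ 0 → a ≤ ‖w‖ → ‖w‖ ≤ 1 / 2 →
      ‖(padeNum ℂ p q).eval w / (padeDen ℂ p q).eval w‖ ≤ c := by
  set K : Set ℂ := {w | w.re ≤ 0} ∩ ({w | a ≤ ‖w‖} ∩ Metric.closedBall 0 (1 / 2)) with hK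
  have hKc : IsCompact K :=
    ((isCompact_closedBall (0 : ℂ) (1 / 2)).inter_left
      (isClosed_le continuous_const continuous_norm)).inter_left
      (isClosed_le Complex.continuous_re continuous_const)
  have hlt : ∀ w ∈ K, ‖(padeNum ℂ p q).eval w‖ < ‖(padeDen ℂ p q).eval w‖ := fun w hw =>
    norm_padeNum_lt_padeDen hq hw.1 (norm_pos_iff.1 (ha.trans_le hw.2.1))
  have hcont : ContinuousOn
      (fun w : ℂ => ‖(padeNum ℂ p q).eval w / (padeDen ℂ p q).eval w‖) K :=
    ((padeNum ℂ p q).continuous.continuousOn.div (padeDen ℂ p q).continuous.continuousOn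
      fun w hw => norm_pos_iff.1 ((norm_nonneg _).trans_lt (hlt w hw))).norm
  have hmem : ∀ w : ℂ, w.re ≤ 0 → a ≤ ‖w‖ → ‖w‖ ≤ 1 / 2 → w ∈ K := fun w h1 h2 h3 =>
    ⟨h1, h2, by simpa using h3⟩
  rcases K.eq_empty_or_nonempty with h0 | hne
  -- The half-annulus is empty when $a>1/2$.
  · exact ⟨0, le_rfl, one_pos, fun w h1 h2 h3 => by simpa [h0] using hmem w h1 h2 h3⟩
  · obtain ⟨x, hx, hmax⟩ := hKc.exists_isMaxOn hne hcont
    refine ⟨_, norm_nonneg _, ?_, fun w h1 h2 h3 => hmax (hmem w h1 h2 h3)⟩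
    rw [norm_div, div_lt_one ((norm_nonneg _).trans_lt (hlt x hx))]
    exact hlt x hx

theorem exists_norm_scaledPade_le {n : Type*} [Fintype n] [DecidableEq n]
    {ν : Seminorm ℂ (Matrix n n ℂ)} (hν : IsMatrixNorm ν) {p q : ℕ} (hq : q = p + 1 ∨ q = p + 2)
    {A B ε : ℝ} (hA : 0 < A) (hB : 0 ≤ B) (hε : 0 < ε) :
    ∃ r : ℝ, ∀ (M : Matrix n n ℂ) (u : n → ℂ) (z : ℂ), u ≠ 0 → Matrix.vecMul u M = z • u →
      z.re ≤ 0 → ν M ≤ ‖z‖ * A + B → r ≤ ‖z‖ → ‖scaledPade p q (scalingExponent ν M) z‖ ≤ ε := by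
  have ha : 0 < 1 / (8 * A) := by positivity
  obtain ⟨c, hc0, hc1, hc⟩ := exists_uniform_contraction hq ha
  obtain ⟨N, hN⟩ := exists_pow_lt_of_lt_one hε hc1
  -- Since $2|z|\le2^\kappa$, the term $N$ yields $N\le2^\kappa$, the $1$ forces $\kappa\ne0$, and
  -- $4B$ gives $4B\le2^\kappa/2$. The last absorbs $B$ in $2^\kappa<4(A|z|+B)$, whence
  -- $2^\kappa<8A|z|$ and the inner radius $1/(8A)$.
  refine ⟨N + 4 * B + 1, fun M u z hu h hz hM hr => ?_⟩
  have hhalf := norm_scaled_le_half hν hu h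
  set κ := scalingExponent ν M with hκ
  have hre := re_scaled_nonpos hz κ
  have hnorm : ‖(2 : ℂ)⁻¹ ^ κ * z‖ = ‖z‖ / 2 ^ κ := by
    rw [norm_mul, norm_inv_two_pow, inv_mul_eq_div]
  have hN0 : (0 : ℝ) ≤ N := N.cast_nonneg
  have h2 : (0 : ℝ) < 2 ^ κ := by positivity
  have hbig : 2 * ‖z‖ ≤ 2 ^ κ := by
    rw [hnorm, div_le_iff₀ h2] at hhalf
    linarith
  have hκ0 : κ ≠ 0 := by
    intro h0
    rw [h0, pow_zero] at hbig
    linarith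
  have hmin : (2 : ℝ) ^ κ < 4 * ν M := two_pow_scalingExponent_lt hκ0
  have hlow : 1 / (8 * A) ≤ ‖(2 : ℂ)⁻¹ ^ κ * z‖ := by
    rw [hnorm, div_le_div_iff₀ (by positivity) h2]
    linarith
  have hle := hc _ hre hlow hhalf
  rw [scaledPade, norm_pow]
  have hNle : N ≤ 2 ^ κ := by
    have : (N : ℝ) ≤ ((2 ^ κ : ℕ) : ℝ) := by
      push_cast
      linarith
    exact_mod_cast this
  exact (pow_le_pow_left₀ (norm_nonneg _) hle _).trans
    ((pow_le_pow_of_le_one hc0 hc1.le hNle).trans hN.le)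

theorem seminorm_augAutonomous_le (ν : Seminorm ℂ (Matrix (Fin 1 ⊕ Fin 1) (Fin 1 ⊕ Fin 1) ℂ))
    (B : ℝ) : ∃ A, 0 < A ∧ ∀ (lam : ℂ) (t : ℝ) (y : Fin 1 → ℂ) (h : ℝ), ‖y‖ ≤ B →
      ν ((h : ℂ) • augAutonomous (testField lam) t y) ≤ ‖(h : ℂ) * lam‖ * A := by
  set E₁ : Matrix (Fin 1 ⊕ Fin 1) (Fin 1 ⊕ Fin 1) ℂ := Matrix.fromBlocks 1 0 0 0
  set E₂ : Matrix (Fin 1 ⊕ Fin 1) (Fin 1 ⊕ Fin 1) ℂ :=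
    Matrix.fromBlocks 0 (Matrix.of fun _ _ => 1) 0 0
  have h1 := apply_nonneg ν E₁
  have h2 := apply_nonneg ν E₂
  refine ⟨ν E₁ + |B| * ν E₂ + 1, by positivity, fun lam t y h hy => ?_⟩
  have e : (h : ℂ) • augAutonomous (testField lam) t y = ((h : ℂ) * lam) • (E₁ + y 0 • E₂) := by
    rw [augAutonomous_testField]
    ext i j
    rcases i with i | i <;> rcases j with j | j <;> fin_cases i <;> fin_cases j <;>
      simp [E₁, E₂, mul_assoc]
  have hy0 : ‖y 0‖ ≤ |B| := (norm_le_pi_norm y 0).trans (hy.trans (le_abs_self B))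
  rw [e, map_smul_eq_mul]
  refine mul_le_mul_of_nonneg_left ((map_add_le_add ν _ _).trans ?_) (norm_nonneg _)
  rw [map_smul_eq_mul]
  have := mul_le_mul_of_nonneg_right hy0 h2
  linarith

theorem seminorm_augNonautonomous_le
    (ν : Seminorm ℂ (Matrix (Fin 1 ⊕ Fin 2) (Fin 1 ⊕ Fin 2) ℂ)) (B H : ℝ) :
    ∃ A C, 0 < A ∧ 0 ≤ C ∧ ∀ (lam : ℂ) (t : ℝ) (y : Fin 1 → ℂ) (h : ℝ), 0 < h → h ≤ H → ‖y‖ ≤ B →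
      ν ((h : ℂ) • augNonautonomous (testField lam) t y) ≤ ‖(h : ℂ) * lam‖ * A + C := by
  set E₁ : Matrix (Fin 1 ⊕ Fin 2) (Fin 1 ⊕ Fin 2) ℂ := Matrix.fromBlocks 1 0 0 0
  set E₂ : Matrix (Fin 1 ⊕ Fin 2) (Fin 1 ⊕ Fin 2) ℂ :=
    Matrix.fromBlocks 0 (Matrix.of fun _ => ![0, 1]) 0 0
  set E₃ : Matrix (Fin 1 ⊕ Fin 2) (Fin 1 ⊕ Fin 2) ℂ := Matrix.fromBlocks 0 0 0 !![0, 1; 0, 0]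
  have h1 := apply_nonneg ν E₁
  have h2 := apply_nonneg ν E₂
  have h3 := apply_nonneg ν E₃
  refine ⟨ν E₁ + |B| * ν E₂ + 1, |H| * ν E₃, by positivity, by positivity,
    fun lam t y h hpos hH hy => ?_⟩
  -- The time block scales with $h$ alone, not with $h\lambda$; hence the additive constant and the
  -- bound on $h$.
  have e : (h : ℂ) • augNonautonomous (testField lam) t y =
      ((h : ℂ) * lam) • (E₁ + y 0 • E₂) + (h : ℂ) • E₃ := by
    rw [augNonautonomous_testField]
    ext i j
    rcases i with i | i <;> rcases j with j | j <;> fin_cases i <;> fin_cases j <;>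
      simp [E₁, E₂, E₃, mul_assoc]
  have hy0 : ‖y 0‖ ≤ |B| := (norm_le_pi_norm y 0).trans (hy.trans (le_abs_self B))
  have hh : ‖(h : ℂ)‖ ≤ |H| := by
    rw [Complex.norm_real, Real.norm_of_nonneg hpos.le]
    exact hH.trans (le_abs_self H)
  rw [e]
  refine (map_add_le_add ν _ _).trans ?_
  rw [map_smul_eq_mul, map_smul_eq_mul]
  refine add_le_add (mul_le_mul_of_nonneg_left ((map_add_le_add ν _ _).trans ?_) (norm_nonneg _))
    (mul_le_mul_of_nonneg_right hh h3)
  rw [map_smul_eq_mul]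
  have := mul_le_mul_of_nonneg_right hy0 h2
  linarith

theorem re_ofReal_mul_nonpos {lam : ℂ} {h : ℝ} (hlam : lam.re ≤ 0) (hh : 0 < h) :
    ((h : ℂ) * lam).re ≤ 0 := by
  rw [Complex.re_ofReal_mul]
  exact mul_nonpos_of_nonneg_of_nonpos hh.le hlam

theorem sumElim_one_ne_zero {m : ℕ} (v : Fin m → ℂ) :
    (Sum.elim 1 v : Fin 1 ⊕ Fin m → ℂ) ≠ 0 := fun h => by
  simpa using congrFun h (Sum.inl 0)

theorem mainTheorem2 (p q : ℕ) (hpq : p ≤ q) (hqp : q ≤ p + 2) (s : ℕ) (rk : RKCoeffs s)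
    (ν₁ : Seminorm ℂ (Matrix (Fin 1 ⊕ Fin 1) (Fin 1 ⊕ Fin 1) ℂ)) (hν₁ : IsMatrixNorm ν₁)
    (ν₂ : Seminorm ℂ (Matrix (Fin 1 ⊕ Fin 2) (Fin 1 ⊕ Fin 2) ℂ)) (hν₂ : IsMatrixNorm ν₂) :
    (IsAStable (llrkAutonomous ν₁ p q rk) ∧ IsAStable (llrkNonautonomous ν₂ p q rk)) ∧
    ((q = p + 1 ∨ q = p + 2) →
      IsLStable (llrkAutonomous ν₁ p q rk) ∧ IsLStable (llrkNonautonomous ν₂ p q rk)) := by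
  have amp₁ := fun (lam : ℂ) (t : ℝ) (y : Fin 1 → ℂ) (h : ℝ) (hlam : lam.re ≤ 0) (hh : 0 < h) =>
    llrkAutonomous_testField hpq hqp rk ν₁ t y hlam hh
  have amp₂ := fun (lam : ℂ) (t : ℝ) (y : Fin 1 → ℂ) (h : ℝ) (hlam : lam.re ≤ 0) (hh : 0 < h) =>
    llrkNonautonomous_testField hpq hqp rk ν₂ t y hlam hh
  have bdd : ∀ (κ : ℂ → ℝ → (Fin 1 → ℂ) → ℝ → ℕ),
      FactorBounded fun lam t y h => scaledPade p q (κ lam t y h) (h * lam) :=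
    fun κ lam t y h hlam hh => norm_scaledPade_le_one hpq hqp (re_ofReal_mul_nonpos hlam hh) _
  refine ⟨⟨⟨_, amp₁, bdd _⟩, ⟨_, amp₂, bdd _⟩⟩, fun hq =>
    ⟨⟨_, amp₁, bdd _, fun B H ε hε => ?_⟩, ⟨_, amp₂, bdd _, fun B H ε hε => ?_⟩⟩⟩
  · obtain ⟨A, hA, hle⟩ := seminorm_augAutonomous_le ν₁ B
    obtain ⟨r, hr⟩ := exists_norm_scaledPade_le hν₁ hq hA le_rfl hε
    refine ⟨r, fun lam t y h hlam hh _ hy hrz => hr _ _ _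
      (sumElim_one_ne_zero (Pi.single (Fin.last _) (y 0))) ?_
      (re_ofReal_mul_nonpos hlam hh) ((hle lam t y h hy).trans (add_zero _).ge) hrz⟩
    rw [Matrix.vecMul_smul, vecMul_augAutonomous, smul_smul]
  · obtain ⟨A, C, hA, hC, hle⟩ := seminorm_augNonautonomous_le ν₂ B H
    obtain ⟨r, hr⟩ := exists_norm_scaledPade_le hν₂ hq hA hC hε
    refine ⟨r, fun lam t y h hlam hh hH hy hrz => hr _ _ _
      (sumElim_one_ne_zero (Pi.single (Fin.last _) (y 0))) ?_
      (re_ofReal_mul_nonpos hlam hh) (hle lam t y h hh hH hy) hrz⟩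
    rw [Matrix.vecMul_smul, vecMul_augNonautonomous, smul_smul]
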